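/- Let $n\ge 4$ be an integer and let $s=n-2$. A monic hyperbolic polynomial is a monic polynomial in $\mathbb{R}[T]$ all of whose roots are real. For a monic hyperbolic polynomial $F=T^n+F_1T^{n-1}+\dots+F_n$ of degree $n$, the hyperbolic slice $\mathcal{H}_s(F)$ is the set of all monic hyperbolic polynomials $H=T^n+H_1T^{n-1}+\dots+H_n$ of degree $n$ with $H_i=F_i$ for $i=1,\dots,s$. For a monic hyperbolic polynomial $G$ of degree $n$, let $p(G)$ be the partition of $n$ whose parts are the multiplicities of the distinct roots of $G$. For partitions $p,q$ of $n$ write $p\le q$ if $p$ can be obtained from $q$ by summing some of the parts of $q$ (grouping the parts of $q$ into blocks and replacing each block by its sum) and reordering. A set $P$ of partitions of $n$ into $s$ parts is an $(n,s)$-Vandermonde covering if for every monic hyperbolic polynomial $F$ of degree $n$ there are $q\in P$ and $G\in\mathcal{H}_s(F)$ with $p(G)\le q$. Then the one-element set $\{(2,2,1,\dots,1)\}$, where $(2,2,1,\dots,1)$ is the partition of $n$ with two parts equal to $2$ and $n-4$ parts equal to $1$, is an $(n,n-2)$-Vandermonde covering. -/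

import Mathlib

open Polynomial

/-- `F` is a monic hyperbolic polynomial of degree `n`: a monic real univariate polynomial of
degree `n` all of whose roots are real, i.e. which is a product of linear factors over `ℝ`. -/
def IsHyperbolic (n : ℕ) (F : ℝ[X]) : Prop :=
  F.Monic ∧ F.natDegree = n ∧ F.Splits

/-- The hyperbolic slice `H_s(F)` of a polynomial `F` of degree `n`: all monic hyperbolic
polynomials `H = T ^ n + H_1 T ^ (n - 1) + ⋯ + H_n` of degree `n` with `H_i = F_i` for
`i = 1, …, s`, where `H_i` is the coefficient of `T ^ (n - i)`. It is used for `s ≤ n`. -/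
def hyperbolicSlice (n s : ℕ) (F : ℝ[X]) : Set ℝ[X] :=
  {H | IsHyperbolic n H ∧ ∀ i : ℕ, 1 ≤ i → i ≤ s → H.coeff (n - i) = F.coeff (n - i)}

/-- The partition `p(G)` of `n` that corresponds to a monic hyperbolic polynomial `G` of degree
`n`: its parts are the multiplicities of the distinct roots of `G`. -/
noncomputable def rootPartition {n : ℕ} (G : ℝ[X]) (hG : IsHyperbolic n G) : Nat.Partition n where
  parts := G.roots.toFinset.val.map fun x => G.rootMultiplicity x
  parts_pos := by
    intro i hi
    obtain ⟨x, hx, rfl⟩ := Multiset.mem_map.1 hi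
    have hx' : x ∈ G.roots := Multiset.mem_toFinset.1 hx
    rw [← count_roots]
    exact Multiset.count_pos.2 hx'
  parts_sum := by
    have h : (∑ x ∈ G.roots.toFinset, G.roots.count x) = n := by
      rw [Multiset.toFinset_sum_count_eq, ← hG.2.2.natDegree_eq_card_roots, hG.2.1]
    simpa only [count_roots, Finset.sum] using h

/-- The order `p ≤ q` on the partitions of `n`: `p` is obtained from `q` by splitting the parts
of `q` into blocks and replacing every block by the sum of its members. -/
def PartitionLE {n : ℕ} (p q : Nat.Partition n) : Prop :=
  ∃ B : Multiset (Multiset ℕ), B.join = q.parts ∧ B.map Multiset.sum = p.parts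

/-- `P` is an `(n, s)`-Vandermonde covering: `P` consists of partitions of `n` into `s` parts, and
every hyperbolic slice `H_s(F)`, with `F` monic hyperbolic of degree `n`, contains a polynomial
`G` such that `p(G) ≤ q` for some `q` in `P`. -/
def IsVandermondeCovering (n s : ℕ) (P : Set (Nat.Partition n)) : Prop :=
  (∀ q ∈ P, q.parts.card = s) ∧
    ∀ F : ℝ[X], IsHyperbolic n F →
      ∃ q ∈ P, ∃ G : ℝ[X], ∃ hG : G ∈ hyperbolicSlice n s F,
        PartitionLE (rootPartition G hG.1) q

/-- The partition `(2, 2, 1, …, 1)` of `n ≥ 4`, with `n - 4` parts equal to `1`. -/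
def twoTwoOnes (n : ℕ) (hn : 4 ≤ n) : Nat.Partition n where
  parts := 2 ::ₘ 2 ::ₘ Multiset.replicate (n - 4) 1
  parts_pos := by
    intro i hi
    simp only [Multiset.mem_cons, Multiset.mem_replicate] at hi
    omega
  parts_sum := by
    simp only [Multiset.sum_cons, Multiset.sum_replicate, smul_eq_mul]
    omega

/-! Fixing the coefficients of degree at least 2 turns the slice into a set in the plane of the last
two coefficients `(a, b)`. It is compact, since the two leading nontrivial coefficients fix the sum
of the squares of the roots.

Let `F` have simple roots, and suppose that no member of the slice is divisible by some `(X - u)^2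
(X - v)^2`. A member with simple roots can move in every direction of the plane. A member with one
double root `x` and otherwise simple roots can move both ways along `(1, -x)`, and its roots become
simple. Neither maximises a nonzero linear functional, so every maximiser has a triple root
(`exists_cube_dvd_of_forall_not_dvd`).

Laguerre's inequality, strict off the roots, limits such points: all other members lie strictly on
one side of a triple-root member in the coordinate `a` (`coeff_zero_eq_of_cube_dvd`,
`coeff_one_sub_mul_eval_derivative_neg`). Suitable functionals yield three of them with distinct
`a`, and the middle one is contradictory.

For arbitrary `F`, perturb the roots to be distinct and pass to a limit; having two pairs of equal
roots is a closed condition. -/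

open Filter Topology

/-! ### Laguerre's inequality -/

/-- A splitting real polynomial satisfies `p p'' ≤ p' ^ 2`. -/
theorem laguerre_multiset (s : Multiset ℝ) (z : ℝ) :
    let p := (s.map fun x => X - C x).prod
    0 ≤ p.derivative.eval z ^ 2 - p.eval z * p.derivative.derivative.eval z ∧
      (s ≠ 0 → p.eval z ≠ 0 →
        0 < p.derivative.eval z ^ 2 - p.eval z * p.derivative.derivative.eval z) := by
  induction s using Multiset.induction_on with
  | empty => simp
  | cons c s ih =>
    simp only [Multiset.map_cons, Multiset.prod_cons] at ih ⊢
    set q := (s.map fun x => X - C x).prod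
    have key : ((X - C c) * q).derivative.eval z ^ 2
        - ((X - C c) * q).eval z * ((X - C c) * q).derivative.derivative.eval z
        = q.eval z ^ 2 + (z - c) ^ 2 *
          (q.derivative.eval z ^ 2 - q.eval z * q.derivative.derivative.eval z) := by
      simp [derivative_mul]
      ring
    rw [key]
    refine ⟨add_nonneg (sq_nonneg _) (mul_nonneg (sq_nonneg _) ih.1), fun _ h => ?_⟩
    have hq : q.eval z ≠ 0 := by
      intro h0
      simp [h0] at h
    exact add_pos_of_pos_of_nonneg (by positivity) (mul_nonneg (sq_nonneg _) ih.1)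

/-- At a critical point that is not a root, a splitting real polynomial and its second derivative
have opposite signs. -/
theorem Polynomial.Splits.eval_mul_eval_derivative_two_neg {p : ℝ[X]} (hp : p.Splits)
    (hdeg : p.natDegree ≠ 0) {z : ℝ} (h0 : p.eval z ≠ 0) (h1 : p.derivative.eval z = 0) :
    p.eval z * p.derivative.derivative.eval z < 0 := by
  have hroots : p.roots ≠ 0 := hp.roots_ne_zero hdeg
  have hl := laguerre_multiset p.roots z
  have hfac := hp.eq_prod_roots
  set q := (p.roots.map fun x => X - C x).prod
  set l := p.leadingCoeff
  have e0 : p.eval z = l * q.eval z := by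
    conv_lhs => rw [hfac]
    simp
  have e1 : p.derivative.eval z = l * q.derivative.eval z := by
    conv_lhs => rw [hfac]
    simp
  have e2 : p.derivative.derivative.eval z = l * q.derivative.derivative.eval z := by
    conv_lhs => rw [hfac]
    simp
  rw [e0] at h0
  have hq := right_ne_zero_of_mul h0
  have hl0 := left_ne_zero_of_mul h0
  rw [e1] at h1
  have hq1 : q.derivative.eval z = 0 := (mul_eq_zero.1 h1).resolve_left hl0
  have := hl.2 hroots hq
  rw [hq1] at this
  rw [e0, e2]
  have hl2 : 0 < l ^ 2 := by positivity
  nlinarith [mul_pos hl2 this]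

/-- Rolle's theorem: passing to the derivative loses at most one root, counted with multiplicity. -/
theorem Polynomial.Splits.derivative_real {p : ℝ[X]} (hp : p.Splits) : p.derivative.Splits := by
  rw [splits_iff_card_roots] at hp ⊢
  have h1 := card_roots_le_derivative p
  have h2 := card_roots' p.derivative
  have h3 : p.derivative.natDegree = p.natDegree - 1 := natDegree_derivative p
  rcases Nat.eq_zero_or_pos p.natDegree with h | h <;> omega

/-! ### Stability of simple real roots -/

/-- A simple real root persists, up to a small displacement, under small perturbations. -/
theorem eventually_exists_root_add {p r : ℝ[X]} {x : ℝ} (q : ℝ[X]) (hp : p = (X - C x) * r)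
    (hr : r.eval x ≠ 0) {U : Set ℝ} (hU : U ∈ 𝓝 x) :
    ∀ᶠ ε in 𝓝 (0 : ℝ), ∃ y ∈ U, (p + C ε * q).eval y = 0 := by
  have hV : {y | 0 < r.eval y * r.eval x} ∈ 𝓝 x := by
    refine (isOpen_lt continuous_const (by fun_prop)).mem_nhds ?_
    exact mul_self_pos.2 hr
  obtain ⟨d, hd, hsub⟩ := Metric.nhds_basis_closedBall.mem_iff.1 (inter_mem hU hV)
  rw [Real.closedBall_eq_Icc] at hsub
  have h1 : 0 < r.eval (x - d) * r.eval x := (hsub ⟨le_rfl, by linarith⟩).2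
  have h2 : 0 < r.eval (x + d) * r.eval x := (hsub ⟨by linarith, le_rfl⟩).2
  -- The cofactor `r` keeps its sign near `x`, so `p` changes sign there.
  have hneg : p.eval (x - d) * p.eval (x + d) < 0 := by
    have h3 : 0 < r.eval (x - d) * r.eval (x + d) := by
      by_contra h
      have := mul_pos h1 h2
      have h4 : 0 < r.eval x ^ 2 := by positivity
      nlinarith
    have h5 : 0 < d ^ 2 := by positivity
    rw [hp]
    simp only [eval_mul, eval_sub, eval_X, eval_C]
    nlinarith [mul_pos h5 h3]
  have hc : Continuous fun ε : ℝ =>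
      (p + C ε * q).eval (x - d) * (p + C ε * q).eval (x + d) := by
    simp only [eval_add, eval_mul, eval_C]
    fun_prop
  have hev : ∀ᶠ ε in 𝓝 (0 : ℝ), (p + C ε * q).eval (x - d) * (p + C ε * q).eval (x + d) < 0 :=
    hc.continuousAt.eventually_lt continuousAt_const (by simpa using hneg)
  filter_upwards [hev] with ε hε
  have hmem : (0 : ℝ) ∈ Set.uIcc ((p + C ε * q).eval (x - d)) ((p + C ε * q).eval (x + d)) := by
    rw [Set.mem_uIcc]
    rcases mul_neg_iff.1 hε with h | h
    · exact Or.inr ⟨h.2.le, h.1.le⟩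
    · exact Or.inl ⟨h.1.le, h.2.le⟩
  obtain ⟨y, hy, hy0⟩ := intermediate_value_uIcc
    (f := fun t => (p + C ε * q).eval t) (Polynomial.continuousOn _) hmem
  rw [Set.uIcc_of_le (by linarith)] at hy
  exact ⟨y, (hsub hy).1, hy0⟩

/-- Real polynomials with only simple real roots are stable under small perturbations by
polynomials of smaller degree. -/
theorem eventually_splits_add {p q : ℝ[X]} (hp : p.Monic) (hs : p.Splits) (hn : p.roots.Nodup)
    (hq : q.degree < p.degree) :
    ∀ᶠ ε in 𝓝 (0 : ℝ), (p + C ε * q).Splits ∧ (p + C ε * q).roots.Nodup := by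
  classical
  obtain ⟨U, hU, hdisj⟩ := p.roots.toFinset.finite_toSet.t2_separation
  have hloc : ∀ x ∈ p.roots.toFinset,
      ∀ᶠ ε in 𝓝 (0 : ℝ), ∃ y ∈ U x, (p + C ε * q).eval y = 0 := by
    intro x hx
    have hx' : x ∈ p.roots := Multiset.mem_toFinset.1 hx
    obtain ⟨r, hr⟩ := dvd_iff_isRoot.2 (isRoot_of_mem_roots hx')
    refine eventually_exists_root_add q hr (fun h0 => ?_) ((hU x).2.mem_nhds (hU x).1)
    obtain ⟨t, ht⟩ := dvd_iff_isRoot.2 (show r.IsRoot x from h0)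
    have hle : 2 ≤ p.rootMultiplicity x := by
      rw [le_rootMultiplicity_iff hp.ne_zero]
      exact ⟨t, by rw [hr, ht]; ring⟩
    have := Multiset.nodup_iff_count_le_one.1 hn x
    rw [count_roots] at this
    omega
  rw [← Finset.eventually_all] at hloc
  filter_upwards [hloc] with ε hε
  choose! y hyU hy0 using hε
  have hdeg : (C ε * q).degree < p.degree := by
    refine lt_of_le_of_lt ?_ hq
    rw [← smul_eq_C_mul]
    exact degree_smul_le ε q
  have hnat : (p + C ε * q).natDegree = p.natDegree := natDegree_add_eq_left_of_degree_lt hdeg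
  have hne : p + C ε * q ≠ 0 := (hp.add_of_left hdeg).ne_zero
  have hinj : Set.InjOn y p.roots.toFinset := by
    intro a ha b hb hab
    by_contra hne'
    exact Set.disjoint_left.1 (hdisj ha hb hne') (hyU a ha) (hab ▸ hyU b hb)
  have hsub : p.roots.toFinset.image y ⊆ (p + C ε * q).roots.toFinset := by
    intro z hz
    obtain ⟨x, hx, rfl⟩ := Finset.mem_image.1 hz
    exact Multiset.mem_toFinset.2 ((mem_roots hne).2 (hy0 x hx))
  have hcard : p.natDegree ≤ (p + C ε * q).roots.toFinset.card := by
    rw [hs.natDegree_eq_card_roots, ← Multiset.toFinset_card_of_nodup hn,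
      ← Finset.card_image_of_injOn hinj]
    exact Finset.card_le_card hsub
  have h1 := Multiset.toFinset_card_le (p + C ε * q).roots
  have h2 := card_roots' (p + C ε * q)
  refine ⟨splits_iff_card_roots.2 (by omega), ?_⟩
  exact Multiset.toFinset_card_eq_card_iff_nodup.1 (by omega)

theorem exists_sq_dvd_of_not_nodup_roots {p : ℝ[X]} (hp : p ≠ 0) (h : ¬ p.roots.Nodup) :
    ∃ x, (X - C x) ^ 2 ∣ p := by
  classical
  rw [Multiset.nodup_iff_count_le_one] at h
  push Not at h
  obtain ⟨x, hx⟩ := h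
  rw [count_roots] at hx
  exact ⟨x, (le_rootMultiplicity_iff hp).1 hx⟩

/-! ### Parametrisation by tuples of roots -/

/-- The monic polynomial with the given family of roots. -/
noncomputable def rootsProd {n : ℕ} (y : Fin n → ℝ) : ℝ[X] := ∏ i, (X - C (y i))

theorem rootsProd_succ {n : ℕ} (y : Fin (n + 1) → ℝ) :
    rootsProd y = (X - C (y 0)) * rootsProd (Fin.tail y) := Fin.prod_univ_succ _

theorem rootsProd_cons {n : ℕ} (a : ℝ) (y : Fin n → ℝ) :
    rootsProd (Fin.cons a y : Fin (n + 1) → ℝ) = (X - C a) * rootsProd y := by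
  rw [rootsProd_succ]; simp

theorem rootsProd_monic {n : ℕ} (y : Fin n → ℝ) : (rootsProd y).Monic :=
  monic_prod_of_monic _ _ fun i _ => monic_X_sub_C (y i)

theorem rootsProd_natDegree {n : ℕ} (y : Fin n → ℝ) : (rootsProd y).natDegree = n := by
  rw [rootsProd, natDegree_finsetProd_X_sub_C_eq_card]
  simp

theorem rootsProd_splits {n : ℕ} (y : Fin n → ℝ) : (rootsProd y).Splits :=
  Splits.prod fun i _ => Splits.X_sub_C (y i)

theorem rootsProd_roots {n : ℕ} (y : Fin n → ℝ) :
    (rootsProd y).roots = Finset.univ.val.map y := by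
  rw [← roots_multiset_prod_X_sub_C (Finset.univ.val.map y), Multiset.map_map]
  rfl

theorem IsHyperbolic.exists_rootsProd {n : ℕ} {p : ℝ[X]} (hp : IsHyperbolic n p) :
    ∃ y : Fin n → ℝ, p = rootsProd y := by
  induction n generalizing p with
  | zero => exact ⟨Fin.elim0, by simpa [rootsProd] using hp.1.natDegree_eq_zero.1 hp.2.1⟩
  | succ n ih =>
    obtain ⟨hm, hd, hs⟩ := hp
    obtain ⟨x, hx⟩ := hs.exists_eval_eq_zero
      (fun h => by have := natDegree_eq_zero_iff_degree_le_zero.2 h.le; omega)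
    obtain ⟨q, rfl⟩ := dvd_iff_isRoot.2 hx
    have hqm : q.Monic := (monic_X_sub_C x).of_mul_monic_left hm
    have hqd : q.natDegree = n := by
      rw [(monic_X_sub_C x).natDegree_mul hqm, natDegree_X_sub_C] at hd
      omega
    obtain ⟨y, rfl⟩ := ih ⟨hqm, hqd, splits_X_sub_C_mul_iff.1 hs⟩
    exact ⟨Fin.cons x y, (rootsProd_cons x y).symm⟩

theorem isHyperbolic_rootsProd {n : ℕ} (y : Fin n → ℝ) : IsHyperbolic n (rootsProd y) :=
  ⟨rootsProd_monic y, rootsProd_natDegree y, rootsProd_splits y⟩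

theorem continuous_coeff_rootsProd {n : ℕ} (k : ℕ) :
    Continuous fun y : Fin n → ℝ => (rootsProd y).coeff k := by
  induction n generalizing k with
  | zero => simp only [rootsProd, Finset.univ_eq_empty, Finset.prod_empty]; exact continuous_const
  | succ n ih =>
    have ht : ∀ j, Continuous fun y : Fin (n + 1) → ℝ => (rootsProd (Fin.tail y)).coeff j :=
      fun j => (ih j).comp (by unfold Fin.tail; fun_prop)
    simp only [rootsProd_succ, sub_mul, coeff_sub, coeff_C_mul]
    refine .sub ?_ ((continuous_apply 0).mul (ht k))
    cases k with
    | zero => simpa using continuous_const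
    | succ k => simpa using ht k

/-- Newton's identity for the second power sum; it bounds the roots throughout a slice. -/
theorem sum_sq_eq_coeff_rootsProd {n : ℕ} (y : Fin (n + 2) → ℝ) :
    ∑ i, y i ^ 2 = (rootsProd y).coeff (n + 1) ^ 2 - 2 * (rootsProd y).coeff n := by
  induction n with
  | zero =>
    simp [rootsProd, Fin.prod_univ_two, Fin.sum_univ_two, sub_mul, mul_sub, coeff_X, coeff_C]
    ring
  | succ n ih =>
    have hlead : (rootsProd (Fin.tail y)).coeff (n + 2) = 1 := by
      have := (rootsProd_monic (Fin.tail y)).coeff_natDegree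
      rwa [rootsProd_natDegree] at this
    rw [Fin.sum_univ_succ, show ∑ i : Fin (n + 2), y i.succ ^ 2 = _ from ih (Fin.tail y),
      rootsProd_succ y]
    simp only [sub_mul, coeff_sub, coeff_C_mul, coeff_X_mul, hlead]
    ring

/-! ### Triple roots in a slice -/

theorem mem_hyperbolicSlice_iff {m : ℕ} {f p : ℝ[X]} (hf : IsHyperbolic (m + 4) f) :
    p ∈ hyperbolicSlice (m + 4) (m + 2) f ↔
      IsHyperbolic (m + 4) p ∧ ∀ k, 2 ≤ k → p.coeff k = f.coeff k := by
  refine and_congr_right fun hp => ⟨fun h k hk => ?_, fun h i _ hi => h _ (by omega)⟩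
  rcases lt_trichotomy k (m + 4) with hlt | rfl | hlt
  · have := h (m + 4 - k) (by omega) (by omega)
    rwa [show m + 4 - (m + 4 - k) = k by omega] at this
  · have h1 := hp.1.coeff_natDegree
    have h2 := hf.1.coeff_natDegree
    rw [hp.2.1] at h1
    rw [hf.2.1] at h2
    rw [h1, h2]
  · rw [coeff_eq_zero_of_natDegree_lt (by rw [hp.2.1]; exact hlt),
      coeff_eq_zero_of_natDegree_lt (by rw [hf.2.1]; exact hlt)]

theorem eq_add_linear_of_coeff_eq {p q : ℝ[X]} (h : ∀ k, 2 ≤ k → p.coeff k = q.coeff k) :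
    p = q + C (p.coeff 1 - q.coeff 1) * X + C (p.coeff 0 - q.coeff 0) := by
  ext k
  match k with
  | 0 => simp
  | 1 => simp [coeff_C]
  | k + 2 => simp [h (k + 2) (by omega)]

theorem eval_derivatives_eq_zero_of_cube_dvd {p : ℝ[X]} {z : ℝ} (h : (X - C z) ^ 3 ∣ p) :
    p.eval z = 0 ∧ p.derivative.eval z = 0 ∧ p.derivative.derivative.eval z = 0 := by
  obtain ⟨t, rfl⟩ := h
  simp [derivative_mul, derivative_pow]

/-- Otherwise `p` is `q` plus a nonzero constant, so at `z` it is nonzero while its first two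
derivatives vanish, against Laguerre. -/
theorem coeff_zero_eq_of_cube_dvd {n : ℕ} {p q : ℝ[X]} (hn : n ≠ 0) (hp : IsHyperbolic n p)
    (h : ∀ k, 2 ≤ k → p.coeff k = q.coeff k) (h1 : p.coeff 1 = q.coeff 1) {z : ℝ}
    (hz : (X - C z) ^ 3 ∣ q) : p.coeff 0 = q.coeff 0 := by
  obtain ⟨z0, z1, z2⟩ := eval_derivatives_eq_zero_of_cube_dvd hz
  have hpq := eq_add_linear_of_coeff_eq h
  set b := p.coeff 0 - q.coeff 0 with hb
  rw [h1, sub_self, C_0, zero_mul, add_zero] at hpq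
  by_contra hne
  have e0 : p.eval z = b := by rw [hpq]; simp [z0]
  have e1 : p.derivative.eval z = 0 := by rw [hpq]; simp [z1]
  have e2 : p.derivative.derivative.eval z = 0 := by rw [hpq]; simp [z2]
  have := hp.2.2.eval_mul_eval_derivative_two_neg (by rw [hp.2.1]; exact hn)
    (by rw [e0]; exact sub_ne_zero.2 hne) e1
  rw [e2, mul_zero] at this
  exact lt_irrefl _ this

/-- Laguerre for `p'`: at `z` its value is the difference of linear coefficients, its derivative
vanishes, and its second derivative is that of `q'`. The sign of the difference is thus dictated by
`q` alone. -/
theorem coeff_one_sub_mul_eval_derivative_neg {n : ℕ} {p q : ℝ[X]} (hn : 2 ≤ n)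
    (hp : IsHyperbolic n p) (h : ∀ k, 2 ≤ k → p.coeff k = q.coeff k)
    (h1 : p.coeff 1 ≠ q.coeff 1) {z : ℝ} (hz : (X - C z) ^ 3 ∣ q) :
    (p.coeff 1 - q.coeff 1) * q.derivative.derivative.derivative.eval z < 0 := by
  obtain ⟨-, z1, z2⟩ := eval_derivatives_eq_zero_of_cube_dvd hz
  have hpq := eq_add_linear_of_coeff_eq h
  set a := p.coeff 1 - q.coeff 1 with ha
  have e0 : p.derivative.eval z = a := by rw [hpq]; simp [z1]
  have e1 : p.derivative.derivative.eval z = 0 := by rw [hpq]; simp [z2]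
  have e2 : p.derivative.derivative.derivative.eval z
      = q.derivative.derivative.derivative.eval z := by rw [hpq]; simp
  have hdeg : p.derivative.natDegree ≠ 0 := by
    rw [natDegree_derivative, hp.2.1]
    omega
  have := hp.2.2.derivative_real.eval_mul_eval_derivative_two_neg hdeg
    (by rw [e0]; exact sub_ne_zero.2 h1) e1
  rwa [e0, e2] at this

/-- Among three polynomials of the slice with different linear coefficients, the middle one has no
triple root. -/
theorem not_cube_dvd_of_coeff_one_lt {n : ℕ} {p q r : ℝ[X]} (hn : 2 ≤ n)
    (hp : IsHyperbolic n p) (hr : IsHyperbolic n r)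
    (hpq : ∀ k, 2 ≤ k → p.coeff k = q.coeff k) (hrq : ∀ k, 2 ≤ k → r.coeff k = q.coeff k)
    (h1 : p.coeff 1 < q.coeff 1) (h2 : q.coeff 1 < r.coeff 1) (z : ℝ) :
    ¬ (X - C z) ^ 3 ∣ q := by
  intro hz
  have k1 := coeff_one_sub_mul_eval_derivative_neg hn hp hpq h1.ne hz
  have k2 := coeff_one_sub_mul_eval_derivative_neg hn hr hrq h2.ne' hz
  have := pos_of_mul_neg_right k1 (by linarith)
  nlinarith

/-! ### Compactness and extremal members -/

theorem mem_closedBall_of_sum_sq_le {ι : Type*} [Fintype ι] {y : ι → ℝ} {B : ℝ}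
    (h : ∑ i, y i ^ 2 ≤ B) : y ∈ Metric.closedBall (0 : ι → ℝ) √B := by
  rw [mem_closedBall_zero_iff, pi_norm_le_iff_of_nonneg (Real.sqrt_nonneg _)]
  intro i
  rw [Real.norm_eq_abs]
  exact Real.abs_le_sqrt
    ((Finset.single_le_sum (f := fun i => y i ^ 2) (fun _ _ => sq_nonneg _)
      (Finset.mem_univ i)).trans h)

theorem isCompact_setOf_coeff_rootsProd_eq {m : ℕ} (f : ℝ[X]) :
    IsCompact {y : Fin (m + 4) → ℝ | ∀ k, 2 ≤ k → (rootsProd y).coeff k = f.coeff k} := by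
  refine Metric.isCompact_of_isClosed_isBounded ?_ ?_
  · simp only [Set.ofPred_forall]
    exact isClosed_iInter fun k => isClosed_iInter fun _ =>
      isClosed_eq (continuous_coeff_rootsProd k) continuous_const
  · refine Metric.isBounded_closedBall.subset (t := Metric.closedBall 0
      √(f.coeff (m + 3) ^ 2 - 2 * f.coeff (m + 2))) fun y hy => ?_
    refine mem_closedBall_of_sum_sq_le ?_
    rw [sum_sq_eq_coeff_rootsProd y, hy (m + 2 + 1) (by omega), hy (m + 2) (by omega)]

theorem IsHyperbolic.add_of_splits {n : ℕ} {p q : ℝ[X]} (hp : IsHyperbolic n p)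
    (hq : q.degree < p.degree) (hs : (p + q).Splits) : IsHyperbolic n (p + q) :=
  ⟨hp.1.add_of_left hq, by rw [natDegree_add_eq_left_of_degree_lt hq, hp.2.1], hs⟩

/-- A linear functional of the last two coefficients increases at a polynomial with simple
roots. -/
theorem exists_linear_coeff_lt {m : ℕ} {α β : ℝ} (hαβ : α ≠ 0 ∨ β ≠ 0) {p : ℝ[X]}
    (hp : IsHyperbolic (m + 4) p) (hn : p.roots.Nodup) :
    ∃ q, IsHyperbolic (m + 4) q ∧ (∀ k, 2 ≤ k → q.coeff k = p.coeff k) ∧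
      α * p.coeff 1 + β * p.coeff 0 < α * q.coeff 1 + β * q.coeff 0 := by
  have hpd : p.degree = ((m + 4 : ℕ) : WithBot ℕ) := by
    rw [degree_eq_natDegree hp.1.ne_zero, hp.2.1]
  have hdeg : (C α * X + C β : ℝ[X]).degree < p.degree := by
    rw [hpd]
    refine degree_linear_le.trans_lt ?_
    exact_mod_cast (by omega : 1 < m + 4)
  have hev := (eventually_splits_add hp.1 hp.2.2 hn hdeg).filter_mono
    (nhdsWithin_le_nhds (s := Set.Ioi 0))
  obtain ⟨ε, hε, hpos⟩ := (hev.and self_mem_nhdsWithin).exists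
  refine ⟨_, hp.add_of_splits ?_ hε.1, fun k hk => ?_, ?_⟩
  · rw [← smul_eq_C_mul]
    exact (degree_smul_le ε _).trans_lt hdeg
  · have h0 : k ≠ 0 := by omega
    have h1 : 1 ≠ k := by omega
    simp [coeff_C, coeff_X, h0, h1]
  · have h2 : 0 < α ^ 2 + β ^ 2 := by
      rcases hαβ with h | h <;> positivity
    have := mul_pos (Set.mem_Ioi.1 hpos) h2
    simp [coeff_C]
    nlinarith

/-- If exactly one root is double and the others are simple, a polynomial is not extremal for
a linear functional of the last two coefficients. -/
theorem exists_linear_coeff_lt_of_mul {m : ℕ} {α β : ℝ} (hαβ : α ≠ 0 ∨ β ≠ 0) {q : ℝ[X]} {x : ℝ}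
    (hq : IsHyperbolic (m + 3) q) (hn : q.roots.Nodup) (hx : q.eval x = 0) :
    ∃ p, IsHyperbolic (m + 4) p ∧ (∀ k, 2 ≤ k → p.coeff k = ((X - C x) * q).coeff k) ∧
      α * ((X - C x) * q).coeff 1 + β * ((X - C x) * q).coeff 0
        < α * p.coeff 1 + β * p.coeff 0 := by
  have hdeg : (1 : ℝ[X]).degree < q.degree := by
    rw [degree_eq_natDegree hq.1.ne_zero, hq.2.1, degree_one]
    exact_mod_cast (by omega : 0 < m + 3)
  obtain ⟨δ, hδ, hball⟩ := Metric.eventually_nhds_iff.1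
    (eventually_splits_add hq.1 hq.2.2 hn hdeg)
  -- Replacing `q` by `q + ε` changes the functional by `ε * (α - β * x)`. A change of zero
  -- suffices, because the new roots are simple and allow a strict increase afterwards.
  obtain ⟨ε, hε, hε0, hsign⟩ : ∃ ε : ℝ, dist ε 0 < δ ∧ ε ≠ 0 ∧ 0 ≤ ε * (α - β * x) := by
    have hd : |δ / 2| < δ := by rw [abs_of_pos (by linarith)]; linarith
    rcases le_total 0 (α - β * x) with h | h
    · exact ⟨δ / 2, by rwa [Real.dist_0_eq_abs], by positivity, mul_nonneg (by linarith) h⟩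
    · refine ⟨-(δ / 2), by rwa [Real.dist_0_eq_abs, abs_neg], by simpa using hδ.ne', ?_⟩
      nlinarith
  obtain ⟨hs, hnod⟩ := hball hε
  rw [mul_one] at hs hnod
  have hdeg' : (C ε : ℝ[X]).degree < q.degree := degree_C_le.trans_lt (by rwa [degree_one] at hdeg)
  have hr := hq.add_of_splits hdeg' hs
  set r := q + C ε with hr_def
  have hrx : ¬ r.IsRoot x := by simpa [hr_def, IsRoot, hx] using hε0
  have hp : IsHyperbolic (m + 4) ((X - C x) * r) := by
    refine ⟨(monic_X_sub_C x).mul hr.1, ?_, splits_X_sub_C_mul_iff.2 hr.2.2⟩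
    rw [(monic_X_sub_C x).natDegree_mul hr.1, natDegree_X_sub_C, hr.2.1]
    omega
  have hpn : ((X - C x) * r).roots.Nodup := by
    rw [roots_mul hp.1.ne_zero, roots_X_sub_C, Multiset.singleton_add, Multiset.nodup_cons]
    exact ⟨fun h => hrx (isRoot_of_mem_roots h), hnod⟩
  obtain ⟨p, hp1, hp2, hp3⟩ := exists_linear_coeff_lt hαβ hp hpn
  have hexp : (X - C x) * r = (X - C x) * q + C ε * X + C (-(ε * x)) := by
    rw [hr_def, C_neg, C_mul]
    ring
  refine ⟨p, hp1, fun k hk => ?_, lt_of_le_of_lt ?_ hp3⟩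
  · have h0 : k ≠ 0 := by omega
    have h1 : 1 ≠ k := by omega
    rw [hp2 k hk, hexp]
    simp [coeff_C, coeff_X, h0, h1]
  · rw [hexp]
    simp [coeff_C]
    nlinarith

/-- A monic hyperbolic polynomial with multiple roots either has two double roots, a triple root,
or just one multiple root, which is double. -/
theorem IsHyperbolic.exists_mul_nodup_or {n : ℕ} {p : ℝ[X]} (hp : IsHyperbolic (n + 1) p)
    (hn : ¬ p.roots.Nodup) :
    (∃ u v, (X - C u) ^ 2 * (X - C v) ^ 2 ∣ p) ∨ (∃ z, (X - C z) ^ 3 ∣ p) ∨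
      ∃ x q, p = (X - C x) * q ∧ IsHyperbolic n q ∧ q.eval x = 0 ∧ q.roots.Nodup := by
  obtain ⟨x, s, hs⟩ := exists_sq_dvd_of_not_nodup_roots hp.1.ne_zero hn
  set q := (X - C x) * s with hq
  have hpq : p = (X - C x) * q := by rw [hs, hq]; ring
  have hqm : q.Monic := (monic_X_sub_C x).of_mul_monic_left (hpq ▸ hp.1)
  have hqx : q.eval x = 0 := by simp [hq]
  by_cases hqn : q.roots.Nodup
  · refine Or.inr (Or.inr ⟨x, q, hpq, ⟨hqm, ?_, ?_⟩, hqx, hqn⟩)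
    · have := hp.2.1
      rw [hpq, (monic_X_sub_C x).natDegree_mul hqm, natDegree_X_sub_C] at this
      omega
    · exact splits_X_sub_C_mul_iff.1 (hpq ▸ hp.2.2)
  · obtain ⟨v, t, ht⟩ := exists_sq_dvd_of_not_nodup_roots hqm.ne_zero hqn
    by_cases hxv : x = v
    · exact Or.inr (Or.inl ⟨x, t, by rw [hpq, ht, hxv]; ring⟩)
    · have htx : t.IsRoot x := by
        rw [ht] at hqx
        simpa [sub_eq_zero, hxv] using hqx
      obtain ⟨w, hw⟩ := dvd_iff_isRoot.2 htx
      exact Or.inl ⟨x, v, w, by rw [hpq, ht, hw]; ring⟩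

theorem exists_cube_dvd_of_forall_not_dvd {m : ℕ} {f : ℝ[X]} (hf : IsHyperbolic (m + 4) f)
    (hn : f.roots.Nodup)
    (hno : ∀ p, IsHyperbolic (m + 4) p → (∀ k, 2 ≤ k → p.coeff k = f.coeff k) →
      ∀ u v, ¬ (X - C u) ^ 2 * (X - C v) ^ 2 ∣ p)
    {α β : ℝ} (hαβ : α ≠ 0 ∨ β ≠ 0) :
    ∃ p, IsHyperbolic (m + 4) p ∧ (∀ k, 2 ≤ k → p.coeff k = f.coeff k) ∧
      (∃ z, (X - C z) ^ 3 ∣ p) ∧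
      α * f.coeff 1 + β * f.coeff 0 < α * p.coeff 1 + β * p.coeff 0 := by
  obtain ⟨x, hx⟩ := hf.exists_rootsProd
  have hcont : Continuous fun y : Fin (m + 4) → ℝ =>
      α * (rootsProd y).coeff 1 + β * (rootsProd y).coeff 0 :=
    ((continuous_coeff_rootsProd 1).const_mul α).add ((continuous_coeff_rootsProd 0).const_mul β)
  obtain ⟨y, hy, hmax⟩ := (isCompact_setOf_coeff_rootsProd_eq (m := m) f).exists_isMaxOn
    ⟨x, fun k _ => by rw [hx]⟩ hcont.continuousOn
  have hp := isHyperbolic_rootsProd y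
  have hle : ∀ q, IsHyperbolic (m + 4) q → (∀ k, 2 ≤ k → q.coeff k = f.coeff k) →
      α * q.coeff 1 + β * q.coeff 0
        ≤ α * (rootsProd y).coeff 1 + β * (rootsProd y).coeff 0 := by
    intro q hq hqf
    obtain ⟨w, rfl⟩ := hq.exists_rootsProd
    exact hmax hqf
  have hnot : ¬ (rootsProd y).roots.Nodup := by
    intro h
    obtain ⟨q, hq, hqp, hlt⟩ := exists_linear_coeff_lt hαβ hp h
    exact absurd (hle q hq fun k hk => (hqp k hk).trans (hy k hk)) (not_le.2 hlt)
  refine ⟨rootsProd y, hp, hy, ?_, ?_⟩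
  · rcases hp.exists_mul_nodup_or hnot with ⟨u, v, h⟩ | h | ⟨z, q, hpq, hq, hqz, hqn⟩
    · exact absurd h (hno _ hp hy u v)
    · exact h
    · obtain ⟨r, hr, hrp, hlt⟩ := exists_linear_coeff_lt_of_mul hαβ hq hqn hqz
      rw [← hpq] at hrp hlt
      exact absurd (hle r hr fun k hk => (hrp k hk).trans (hy k hk)) (not_le.2 hlt)
  · obtain ⟨q, hq, hqf, hlt⟩ := exists_linear_coeff_lt hαβ hf hn
    exact hlt.trans_le (hle q hq hqf)

theorem exists_sq_mul_sq_dvd_of_nodup {m : ℕ} {f : ℝ[X]} (hf : IsHyperbolic (m + 4) f)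
    (hn : f.roots.Nodup) :
    ∃ p, IsHyperbolic (m + 4) p ∧ (∀ k, 2 ≤ k → p.coeff k = f.coeff k) ∧
      ∃ u v, (X - C u) ^ 2 * (X - C v) ^ 2 ∣ p := by
  by_contra! hno
  have hext := fun α β => exists_cube_dvd_of_forall_not_dvd hf hn hno (α := α) (β := β)
  obtain ⟨p, hp, hpf, ⟨zp, hzp⟩, hlp⟩ := hext 1 0 (Or.inl one_ne_zero)
  obtain ⟨q, hq, hqf, ⟨zq, hzq⟩, hlq⟩ := hext (-1) 0 (Or.inl (by norm_num))
  have hqp1 : q.coeff 1 < p.coeff 1 := by linarith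
  -- The functional is constant on the line through `p` and `q`. Its maximiser and minimiser lie
  -- strictly on opposite sides of the level of `f`, so one of them is off that line.
  obtain ⟨r, hr, hrf, ⟨zr, hzr⟩, hne⟩ : ∃ r, IsHyperbolic (m + 4) r ∧
      (∀ k, 2 ≤ k → r.coeff k = f.coeff k) ∧ (∃ z, (X - C z) ^ 3 ∣ r) ∧
      (p.coeff 0 - q.coeff 0) * (r.coeff 1 - p.coeff 1)
        + (q.coeff 1 - p.coeff 1) * (r.coeff 0 - p.coeff 0) ≠ 0 := by
    obtain ⟨r, hr, hrf, hzr, hlr⟩ :=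
      hext (p.coeff 0 - q.coeff 0) (q.coeff 1 - p.coeff 1) (Or.inr (by linarith))
    obtain ⟨s, hs, hsf, hzs, hls⟩ :=
      hext (-(p.coeff 0 - q.coeff 0)) (-(q.coeff 1 - p.coeff 1)) (Or.inr (by linarith))
    by_cases h : (p.coeff 0 - q.coeff 0) * (r.coeff 1 - p.coeff 1)
        + (q.coeff 1 - p.coeff 1) * (r.coeff 0 - p.coeff 0) = 0
    · exact ⟨s, hs, hsf, hzs, fun h' => by nlinarith⟩
    · exact ⟨r, hr, hrf, hzr, h⟩
  have agree : ∀ {a b : ℝ[X]}, (∀ k, 2 ≤ k → a.coeff k = f.coeff k) →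
      (∀ k, 2 ≤ k → b.coeff k = f.coeff k) → ∀ k, 2 ≤ k → a.coeff k = b.coeff k :=
    fun ha hb k hk => (ha k hk).trans (hb k hk).symm
  have hrp : r.coeff 1 ≠ p.coeff 1 := fun h => by
    have h0 := coeff_zero_eq_of_cube_dvd (by omega) hr (agree hrf hpf) h hzp
    exact hne (by rw [h, h0]; ring)
  have hrq : r.coeff 1 ≠ q.coeff 1 := fun h => by
    have h0 := coeff_zero_eq_of_cube_dvd (by omega) hr (agree hrf hqf) h hzq
    exact hne (by rw [h, h0]; ring)
  rcases lt_or_gt_of_ne hrq with h | h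
  · exact not_cube_dvd_of_coeff_one_lt (by omega) hr hp (agree hrf hqf) (agree hpf hqf) h hqp1
      zq hzq
  rcases lt_or_gt_of_ne hrp with h' | h'
  · exact not_cube_dvd_of_coeff_one_lt (by omega) hq hp (agree hqf hrf) (agree hpf hrf) h h' zr hzr
  · exact not_cube_dvd_of_coeff_one_lt (by omega) hq hr (agree hqf hpf) (agree hrf hpf) hqp1 h'
      zp hzp

/-! ### Limits for arbitrary roots -/

theorem IsHyperbolic.exists_rootsProd_cons {m : ℕ} {p : ℝ[X]} (hp : IsHyperbolic (m + 4) p)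
    {u v : ℝ} (h : (X - C u) ^ 2 * (X - C v) ^ 2 ∣ p) :
    ∃ y : Fin (m + 4) → ℝ, y 0 = y 1 ∧ y 2 = y 3 ∧ p = rootsProd y := by
  obtain ⟨r, rfl⟩ := h
  have hm : ((X - C u) ^ 2 * (X - C v) ^ 2).Monic :=
    ((monic_X_sub_C u).pow 2).mul ((monic_X_sub_C v).pow 2)
  have hrm : r.Monic := hm.of_mul_monic_left hp.1
  have hrd : r.natDegree = m := by
    have := hp.2.1
    rw [hm.natDegree_mul hrm, ((monic_X_sub_C u).pow 2).natDegree_mul ((monic_X_sub_C v).pow 2),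
      natDegree_pow, natDegree_pow, natDegree_X_sub_C, natDegree_X_sub_C] at this
    omega
  obtain ⟨w, rfl⟩ := IsHyperbolic.exists_rootsProd (n := m)
    ⟨hrm, hrd, hp.2.2.of_dvd hp.1.ne_zero (dvd_mul_left _ _)⟩
  refine ⟨(Fin.cons u (Fin.cons u (Fin.cons v (Fin.cons v w : Fin (m + 1) → ℝ) :
    Fin (m + 2) → ℝ) : Fin (m + 3) → ℝ) : Fin (m + 4) → ℝ), rfl, rfl, ?_⟩
  simp only [rootsProd_cons]
  ring

/-- Each pair of distinct indices collides for at most one `ε`. -/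
theorem eventually_injective_add_mul {n : ℕ} (x : Fin n → ℝ) :
    ∀ᶠ ε in 𝓝[>] (0 : ℝ), Function.Injective fun i => x i + ε * (i : ℝ) := by
  have h : ∀ i j : Fin n, ∀ᶠ ε in 𝓝[>] (0 : ℝ), x i + ε * (i : ℝ) = x j + ε * (j : ℝ) → i = j := by
    intro i j
    by_cases hij : i = j
    · exact Eventually.of_forall fun _ _ => hij
    have hij' : (i : ℝ) - j ≠ 0 := by
      rw [sub_ne_zero]
      exact fun h => hij (Fin.ext (by exact_mod_cast h))
    have hcast : ∀ ε : ℝ, x i + ε * (i : ℝ) = x j + ε * (j : ℝ) → ε = (x j - x i) / (i - j) :=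
      fun ε h => by rw [eq_div_iff hij']; linarith
    by_cases h0 : (x j - x i) / ((i : ℝ) - j) = 0
    · filter_upwards [self_mem_nhdsWithin] with ε hε he
      exact absurd ((hcast ε he).trans h0) (ne_of_gt hε)
    · filter_upwards [nhdsWithin_le_nhds (isOpen_ne.mem_nhds (Ne.symm h0))] with ε hε he
      exact absurd (hcast ε he) hε
  filter_upwards [eventually_all.2 fun i => eventually_all.2 (h i)] with ε hε i j hij
  exact hε i j hij

theorem exists_rootsProd_coeff_eq {m : ℕ} (x : Fin (m + 4) → ℝ) :
    ∃ y : Fin (m + 4) → ℝ, y 0 = y 1 ∧ y 2 = y 3 ∧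
      ∀ k, 2 ≤ k → (rootsProd y).coeff k = (rootsProd x).coeff k := by
  let x' : ℝ → Fin (m + 4) → ℝ := fun ε i => x i + ε * (i : ℝ)
  have hx' : Continuous x' := by fun_prop
  have hx0 : x' 0 = x := by simp [x']
  have hex : ∀ ε, Function.Injective (x' ε) → ∃ y : Fin (m + 4) → ℝ, y 0 = y 1 ∧ y 2 = y 3 ∧
      ∀ k, 2 ≤ k → (rootsProd y).coeff k = (rootsProd (x' ε)).coeff k := by
    intro ε hε
    have hnod : (rootsProd (x' ε)).roots.Nodup := by
      rw [rootsProd_roots]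
      exact Finset.univ.nodup.map hε
    obtain ⟨p, hp, hpf, u, v, huv⟩ :=
      exists_sq_mul_sq_dvd_of_nodup (isHyperbolic_rootsProd (x' ε)) hnod
    obtain ⟨y, h0, h2, rfl⟩ := hp.exists_rootsProd_cons huv
    exact ⟨y, h0, h2, hpf⟩
  choose! y hy01 hy23 hy using hex
  -- The chosen tuples `y ε` need not depend continuously on `ε`; along an ultrafilter boundedness
  -- alone makes them converge.
  let U := Ultrafilter.of (𝓝[>] (0 : ℝ))
  have hU : (U : Filter ℝ) ≤ 𝓝[>] 0 := Ultrafilter.of_le _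
  have hinj : ∀ᶠ ε in (U : Filter ℝ), Function.Injective (x' ε) :=
    (eventually_injective_add_mul x).filter_mono hU
  have hUx : Tendsto x' U (𝓝 x) :=
    (hx0 ▸ hx'.tendsto 0).mono_left (hU.trans nhdsWithin_le_nhds)
  have hbdd : ∀ᶠ ε in (U : Filter ℝ), ∑ i, x' ε i ^ 2 < ∑ i, x i ^ 2 + 1 := by
    have hc : Continuous fun z : Fin (m + 4) → ℝ => ∑ i, z i ^ 2 := by fun_prop
    exact ((hc.tendsto x).comp hUx).eventually_lt_const (lt_add_one _)
  have hmem : ((U.map y : Ultrafilter _) : Filter (Fin (m + 4) → ℝ)) ≤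
      𝓟 (Metric.closedBall 0 √(∑ i, x i ^ 2 + 1)) := by
    rw [le_principal_iff]
    change ∀ᶠ ε in (U : Filter ℝ), y ε ∈ _
    filter_upwards [hinj, hbdd] with ε h1 h2
    refine mem_closedBall_of_sum_sq_le ?_
    rw [sum_sq_eq_coeff_rootsProd, hy ε h1 _ (by omega), hy ε h1 _ (by omega),
      ← sum_sq_eq_coeff_rootsProd]
    exact h2.le
  obtain ⟨w, -, hw⟩ := (isCompact_closedBall _ _).ultrafilter_le_nhds _ hmem
  have hUy : Tendsto y U (𝓝 w) := hw
  have hUc : ∀ i, Tendsto (fun ε => y ε i) U (𝓝 (w i)) := fun i => tendsto_pi_nhds.1 hUy i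
  refine ⟨w, ?_, ?_, fun k hk => ?_⟩
  · exact tendsto_nhds_unique_of_eventuallyEq (hUc 0) (hUc 1) (hinj.mono hy01)
  · exact tendsto_nhds_unique_of_eventuallyEq (hUc 2) (hUc 3) (hinj.mono hy23)
  · exact tendsto_nhds_unique_of_eventuallyEq
      (((continuous_coeff_rootsProd k).tendsto w).comp hUy)
      (((continuous_coeff_rootsProd k).tendsto x).comp hUx) (hinj.mono fun ε hε => hy ε hε k hk)

/-! ### Partitions of multiplicities -/

theorem Multiset.join_map_filter_fst {α β : Type*} [DecidableEq α] (s : Finset α)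
    (M : Multiset (α × β)) (h : ∀ a ∈ M, a.1 ∈ s) :
    (s.val.map fun x => (M.filter fun a => a.1 = x).map Prod.snd).join = M.map Prod.snd := by
  change ∑ x ∈ s, (M.filter fun a => a.1 = x).map Prod.snd = M.map Prod.snd
  induction M using Multiset.induction_on with
  | empty => simp
  | cons a M ih =>
    have ha : a.1 ∈ s := h a (Multiset.mem_cons_self a M)
    rw [Multiset.map_cons, ← ih fun b hb => h b (Multiset.mem_cons_of_mem hb)]
    have hstep : ∀ x, ((a ::ₘ M).filter fun b => b.1 = x).map Prod.snd
        = (if a.1 = x then {a.2} else 0) + (M.filter fun b => b.1 = x).map Prod.snd := by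
      intro x
      by_cases hx : a.1 = x <;> simp [hx]
    simp only [hstep, Finset.sum_add_distrib, Finset.sum_ite_eq, ha, if_true,
      Multiset.singleton_add]

/-- Weights attached to the roots, which add up to the multiplicities, exhibit the partition of the
root multiplicities as coarser than that of the weights. -/
theorem partitionLE_of_weights {n : ℕ} {G : ℝ[X]} (hG : IsHyperbolic n G) (q : Nat.Partition n)
    (M : Multiset (ℝ × ℕ)) (hroot : ∀ a ∈ M, a.1 ∈ G.roots)
    (hsum : ∀ x, ((M.filter fun a => a.1 = x).map Prod.snd).sum = G.roots.count x)
    (hq : M.map Prod.snd = q.parts) : PartitionLE (rootPartition G hG) q := by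
  refine ⟨G.roots.toFinset.val.map fun x => (M.filter fun a => a.1 = x).map Prod.snd, ?_, ?_⟩
  · rw [Multiset.join_map_filter_fst _ _ fun a ha => Multiset.mem_toFinset.2 (hroot a ha), hq]
  · rw [Multiset.map_map]
    exact Multiset.map_congr rfl fun x _ => by simp [hsum]

/-- The paired roots may coincide with each other or with further roots; grouping the weights `2, 2,
1, …, 1` by root covers these cases. -/
theorem partitionLE_twoTwoOnes {m : ℕ} {y : Fin (m + 4) → ℝ} (h01 : y 0 = y 1) (h23 : y 2 = y 3)
    (hG : IsHyperbolic (m + 4) (rootsProd y)) :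
    PartitionLE (rootPartition (rootsProd y) hG) (twoTwoOnes (m + 4) (by omega)) := by
  have hroots : (rootsProd y).roots = y 0 ::ₘ y 0 ::ₘ y 2 ::ₘ y 2 ::ₘ
      (Finset.univ : Finset (Fin m)).val.map fun i => y i.succ.succ.succ.succ := by
    rw [rootsProd_roots]
    simp only [Fin.univ_succ, Finset.cons_val, Finset.map_val, Multiset.map_cons,
      Multiset.map_map]
    refine congrArg₂ _ rfl (congrArg₂ _ h01.symm (congrArg₂ _ rfl (congrArg₂ _ h23.symm rfl)))
  refine partitionLE_of_weights hG _ ((y 0, 2) ::ₘ (y 2, 2) ::ₘ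
    (Finset.univ : Finset (Fin m)).val.map fun i => (y i.succ.succ.succ.succ, 1)) ?_ ?_ ?_
  · rw [hroots]
    intro a ha
    simp only [Multiset.mem_cons, Multiset.mem_map] at ha ⊢
    rcases ha with rfl | rfl | ⟨i, hi, rfl⟩
    · simp
    · simp
    · exact Or.inr (Or.inr (Or.inr (Or.inr ⟨i, hi, rfl⟩)))
  · intro x
    have hw : ∀ s : Multiset (Fin m), (((s.map fun i => (y i.succ.succ.succ.succ, 1)).filter
        fun a => a.1 = x).map Prod.snd).sum
        = (s.map fun i => y i.succ.succ.succ.succ).count x := by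
      intro s
      induction s using Multiset.induction_on with
      | empty => simp
      | cons i s ih =>
        rw [Multiset.map_cons, Multiset.map_cons, Multiset.count_cons, ← ih, Multiset.filter_cons]
        by_cases h : y i.succ.succ.succ.succ = x
        · simp [h, add_comm]
        · simp [h, Ne.symm h]
    rw [hroots]
    simp only [Multiset.count_cons, Multiset.filter_cons, Multiset.map_add,
      Multiset.sum_add, eq_comm (a := x)]
    rw [hw]
    split_ifs <;> simp only [Multiset.map_singleton, Multiset.sum_singleton, Multiset.map_zero,
      Multiset.sum_zero] <;> omega
  · simp only [twoTwoOnes, Multiset.map_cons, Multiset.map_map, Function.comp_def,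
      Multiset.map_const', Finset.card_val, Finset.card_univ, Fintype.card_fin, Nat.add_sub_cancel]

theorem proposition4 (n : ℕ) (hn : 4 ≤ n) :
    IsVandermondeCovering n (n - 2) {twoTwoOnes n hn} := by
  obtain ⟨m, rfl⟩ : ∃ m, n = m + 4 := ⟨n - 4, by omega⟩
  refine ⟨fun q hq => ?_, fun F hF => ⟨_, rfl, ?_⟩⟩
  · rw [Set.mem_singleton_iff.1 hq]
    simp [twoTwoOnes]
  · obtain ⟨x, rfl⟩ := hF.exists_rootsProd
    obtain ⟨y, h01, h23, hy⟩ := exists_rootsProd_coeff_eq x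
    have hG := isHyperbolic_rootsProd y
    exact ⟨rootsProd y, (mem_hyperbolicSlice_iff hF).2 ⟨hG, hy⟩, partitionLE_twoTwoOnes h01 h23 hG⟩
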